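/- A set covering game with $n\ge 1$ agents consists of a finite set of resources $r$ with values $v_r\ge 0$ and, for each agent $i\in\{1,\dots,n\}$, a finite set $\mathcal A_i$ of subsets of the resource set, with $\emptyset\in\mathcal A_i$ (the null action). For a joint action $a=(a_1,\dots,a_n)$ the welfare is $W(a)=\sum_{r\in\bigcup_i a_i}v_r$. A utility rule is a function $f:\{1,2,\dots\}\to\mathbb R_{\ge 0}$; it induces the utilities $U_i(a)=\sum_{r\in a_i}v_r f(|a|_r)$, where $|a|_r$ is the number of agents $j$ with $r\in a_j$. An action of agent $i$ is a best response to $a$ if it maximizes agent $i$'s utility over $\mathcal A_i$ while the actions of all other agents are kept as in $a$; $a$ is a Nash equilibrium if every $a_i$ is a best response to $a$. In a $1$-round best response process all agents start at the null action and then agents $1,\dots,n$, in this order, each switch once to some best response to the current joint action. Let $$\mathrm{PoA}(f)=\inf\ \frac{\min_{a\text{ Nash equilibrium}}W(a)}{\max_a W(a)},\qquad \mathrm{PoB}(f,1)=\inf\ \frac{\min_{a\text{ possible end state of a 1-round process}}W(a)}{\max_a W(a)},$$ the infima being over all $n\ge1$ and all set covering games with $n$ agents, with $\max_a W(a)>0$,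 under the utility rule $f$. **Theorem 2.** Let $C\in[\tfrac12,1-\tfrac1e]$. Among all utility rules $f$ with $\mathrm{PoA}(f)=C$, the value $\mathrm{PoB}(f,1)$ attains a maximum, and $$\max_{f:\ \mathrm{PoA}(f)=C}\mathrm{PoB}(f,1)=\Bigg[\sum_{j=0}^{\infty}\max\Big\{j!\Big(1-\frac{1-C}{C}\sum_{\tau=1}^{j}\frac1{\tau!}\Big),0\Big\}+1\Bigg]^{-1},$$ where the right-hand side is $0$ if the series diverges. Furthermore, every utility rule $f$ with $\mathrm{PoA}(f)=1-\tfrac1e$ has $\mathrm{PoB}(f,1)=0$. -/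

import Mathlib

open scoped NNReal ENNReal

noncomputable section

/-- A set covering game form with `n` agents (ordered as `Fin n`): a finite set of resources with
nonnegative values and, for each agent, a finite set of actions, each action being a set of
resources. The null action (the empty set) is always available. The agents' utilities are induced
by a utility rule, which is a separate argument below. -/
structure SetCoveringGame (n : ℕ) where
  /-- the resources -/
  Resource : Type
  [fintypeResource : Fintype Resource]
  [decEqResource : DecidableEq Resource]
  /-- the value of a resource -/
  value : Resource → ℝ
  value_nonneg : ∀ r, 0 ≤ value r
  /-- the action set of an agent -/
  actions : Fin n → Finset (Finset Resource)
  null_mem : ∀ i, ∅ ∈ actions i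

/-- A utility rule `f`, with `f j` the multiplier when `j ≥ 1` agents select a resource.
The entry `f 0` is never used. -/
abbrev UtilityRule : Type := ℕ → ℝ≥0

namespace SetCoveringGame

attribute [instance] SetCoveringGame.fintypeResource SetCoveringGame.decEqResource

variable {n : ℕ}

/-- Joint actions. -/
abbrev Profile (G : SetCoveringGame n) : Type := ∀ i : Fin n, {s // s ∈ G.actions i}

/-- The joint action in which every agent plays its null action. -/
def nullProfile (G : SetCoveringGame n) : G.Profile := fun i => ⟨∅, G.null_mem i⟩

/-- The number of agents that select `r`. -/
def count (G : SetCoveringGame n) (a : G.Profile) (r : G.Resource) : ℕ :=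
  (Finset.univ.filter fun i : Fin n => r ∈ (a i).1).card

/-- The welfare: the total value of the covered resources. -/
def welfare (G : SetCoveringGame n) (a : G.Profile) : ℝ :=
  ∑ r ∈ Finset.univ.biUnion fun i : Fin n => (a i).1, G.value r

/-- The utility of agent `i` under the utility rule `f`. -/
def utility (G : SetCoveringGame n) (f : UtilityRule) (i : Fin n) (a : G.Profile) : ℝ :=
  ∑ r ∈ (a i).1, G.value r * (f (G.count a r) : ℝ)

/-- `x` is a best response of agent `i` to the actions of the other agents in `a`. -/
def IsBestResponse (G : SetCoveringGame n) (f : UtilityRule) (i : Fin n) (a : G.Profile)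
    (x : {s // s ∈ G.actions i}) : Prop :=
  ∀ y : {s // s ∈ G.actions i},
    G.utility f i (Function.update a i y) ≤ G.utility f i (Function.update a i x)

/-- The set of (pure) Nash equilibria. -/
def nashEquilibria (G : SetCoveringGame n) (f : UtilityRule) : Set G.Profile :=
  {a | ∀ i, G.IsBestResponse f i a (a i)}

/-- `b` arises from `a` by a best response of agent `i`, all other agents staying put. -/
def BestResponseStep (G : SetCoveringGame n) (f : UtilityRule) (i : Fin n)
    (a b : G.Profile) : Prop :=
  G.IsBestResponse f i a (b i) ∧ ∀ j, j ≠ i → b j = a j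

/-- The possible end states of `k` best response rounds: start at the null profile; for `k * n`
steps the agents best respond one at a time, cyclically in the order of `Fin n`. -/
def endStates (G : SetCoveringGame n) (f : UtilityRule) (k : ℕ) : Set G.Profile :=
  {a | ∃ σ : ℕ → G.Profile,
    σ 0 = G.nullProfile ∧
    (∀ m < k * n, ∀ i : Fin n, i.val = m % n → G.BestResponseStep f i (σ m) (σ (m + 1))) ∧
    σ (k * n) = a}

/-- The optimal welfare, a maximum over the finite nonempty set of joint actions. -/
def optWelfare (G : SetCoveringGame n) : ℝ := sSup (Set.range G.welfare)

/-- The `k`-round price of best response of a game. -/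
def priceOfBestResponse (G : SetCoveringGame n) (f : UtilityRule) (k : ℕ) : ℝ :=
  sInf (G.welfare '' G.endStates f k) / G.optWelfare

/-- The price of anarchy of a game. -/
def priceOfAnarchy (G : SetCoveringGame n) (f : UtilityRule) : ℝ :=
  sInf (G.welfare '' G.nashEquilibria f) / G.optWelfare

end SetCoveringGame

/-- The `k`-round price of best response of `f` over all games with `n` agents. The ratio is only
meaningful for games whose optimal welfare is not zero. -/
def pobN (f : UtilityRule) (n k : ℕ) : ℝ :=
  sInf {x | ∃ G : SetCoveringGame n, 0 < G.optWelfare ∧ x = G.priceOfBestResponse f k}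

/-- The price of anarchy of `f` over all games with `n` agents and nonzero optimal welfare. -/
def poaN (f : UtilityRule) (n : ℕ) : ℝ :=
  sInf {x | ∃ G : SetCoveringGame n, 0 < G.optWelfare ∧ x = G.priceOfAnarchy f}

/-- The `k`-round price of best response of `f`, worst case over the number `n ≥ 1` of agents. -/
def pob (f : UtilityRule) (k : ℕ) : ℝ := ⨅ n : ℕ+, pobN f n k

/-- The price of anarchy of `f`, worst case over the number `n ≥ 1` of agents. -/
def poa (f : UtilityRule) : ℝ := ⨅ n : ℕ+, poaN f n

/-- The trade-off curve. The series has nonnegative terms and is summed in `[0, ∞]`, so that the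
inverse is `0` if the series diverges. -/
def optimalPob (C : ℝ) : ℝ :=
  (((∑' j : ℕ, ENNReal.ofReal
      (max ((j.factorial : ℝ) *
        (1 - (1 - C) / C * ∑ τ ∈ Finset.Icc 1 j, 1 / (τ.factorial : ℝ))) 0)) + 1 : ℝ≥0∞)⁻¹).toReal

end

/-! ### Counts, welfare and the Rosenthal potential. -/

namespace SetCoveringGame

open Finset

/-! Put χ = (1 - C)/C and scale so that f(1) = 1. Two families of games bound any rule with price of
anarchy C. In `cyclicGame` a bad equilibrium forces j f(j) - f(j+1) ≤ χ, so f(j+1) dominates the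
sequence t₀ = 1, t_{j+1} = max((j+1) t_j - χ, 0), whose closed form is the summand of the series. In
`commonGame` one round can leave every agent on a single resource, giving PoB ≤ 1/(1 + ∑ f(j)).
Together these give `pob_le_optimalPob`.

The rule f(j+1) = t_j attains the bound. It is nonincreasing when χ ≥ 1/(e-1), so a smoothness
argument (`welfare_le_of_mem_nashEquilibria`) yields PoA ≥ 1/(1+χ) = C, and `cyclicGame` gives
equality. Telescoping the potential along the round (`welfare_le_of_mem_endStates`) yields PoB ≥
1/(1 + ∑ t_j). At χ = 1/(e-1) the t_j dominate a multiple of the harmonic series, so the bound is 0.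
-/

lemma count_update {n : ℕ} (G : SetCoveringGame n) (a : G.Profile) (i : Fin n)
    (y : {s // s ∈ G.actions i}) (r : G.Resource) :
    G.count (Function.update a i y) r =
      (univ.filter fun j : Fin n => j ≠ i ∧ r ∈ (a j).1).card + if r ∈ y.1 then 1 else 0 := by
  have h : (univ.filter fun j : Fin n => r ∈ (Function.update a i y j).1) =
      (univ.filter fun j : Fin n => j ≠ i ∧ r ∈ (a j).1) ∪
        (if r ∈ y.1 then {i} else ∅) := by
    ext j
    by_cases hj : j = i
    · subst hj
      by_cases hr : r ∈ y.1 <;> simp [hr]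
    · by_cases hr : r ∈ y.1 <;> simp [hr, hj]
  unfold count
  rw [h, card_union_of_disjoint]
  · split_ifs <;> simp
  · rw [disjoint_left]
    intro j hj
    split_ifs <;> simp_all

lemma count_update_eq_add {n : ℕ} (G : SetCoveringGame n) (a : G.Profile) (i : Fin n)
    (y : {s // s ∈ G.actions i}) (r : G.Resource) :
    G.count (Function.update a i y) r =
      G.count (Function.update a i ⟨∅, G.null_mem i⟩) r + if r ∈ y.1 then 1 else 0 := by
  simp [count_update]

lemma count_pos_iff {n : ℕ} (G : SetCoveringGame n) (a : G.Profile) (r : G.Resource) :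
    0 < G.count a r ↔ ∃ i, r ∈ (a i).1 := by
  simp [count, card_pos, Finset.Nonempty]

lemma welfare_eq_sum {n : ℕ} (G : SetCoveringGame n) (a : G.Profile) :
    G.welfare a = ∑ r, if 0 < G.count a r then G.value r else 0 := by
  rw [welfare, ← sum_filter]
  congr 1
  ext r
  simp [count_pos_iff]

lemma utility_eq_sum {n : ℕ} (G : SetCoveringGame n) (f : UtilityRule) (i : Fin n)
    (a : G.Profile) :
    G.utility f i a = ∑ r, if r ∈ (a i).1 then G.value r * (f (G.count a r) : ℝ) else 0 := by
  simp [utility]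

lemma welfare_nonneg {n : ℕ} (G : SetCoveringGame n) (a : G.Profile) : 0 ≤ G.welfare a :=
  sum_nonneg fun r _ => G.value_nonneg r

/-- The Rosenthal potential. -/
def potential {n : ℕ} (G : SetCoveringGame n) (f : UtilityRule) (a : G.Profile) : ℝ :=
  ∑ r, G.value r * ∑ k ∈ range (G.count a r), (f (k + 1) : ℝ)

lemma potential_update {n : ℕ} (G : SetCoveringGame n) (f : UtilityRule) (a : G.Profile)
    (i : Fin n) (y : {s // s ∈ G.actions i}) :
    G.potential f (Function.update a i y) =
      G.potential f (Function.update a i ⟨∅, G.null_mem i⟩) +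
        G.utility f i (Function.update a i y) := by
  rw [potential, potential, utility_eq_sum, ← sum_add_distrib]
  refine sum_congr rfl fun r _ => ?_
  rw [count_update_eq_add G a i y r]
  by_cases hr : r ∈ y.1
  · simp [hr, sum_range_succ, mul_add]
  · simp [hr]

/-- A maximizer of the potential is an equilibrium. Existence matters because the real `sInf` of the
empty set is 0, which would spoil lower bounds. -/
lemma nashEquilibria_nonempty {n : ℕ} (G : SetCoveringGame n) (f : UtilityRule) :
    (G.nashEquilibria f).Nonempty := by
  obtain ⟨a, -, ha⟩ := exists_max_image (univ : Finset G.Profile) (G.potential f)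
    ⟨G.nullProfile, mem_univ _⟩
  refine ⟨a, fun i y => ?_⟩
  have h := ha (Function.update a i y) (mem_univ _)
  have h2 := potential_update G f a i (a i)
  rw [potential_update] at h
  rw [Function.update_eq_self] at h2 ⊢
  linarith

lemma exists_isBestResponse {n : ℕ} (G : SetCoveringGame n) (f : UtilityRule) (i : Fin n)
    (a : G.Profile) : ∃ x, G.IsBestResponse f i a x := by
  obtain ⟨x, -, hx⟩ := exists_max_image (univ : Finset {s // s ∈ G.actions i})
    (fun x => G.utility f i (Function.update a i x)) ⟨⟨∅, G.null_mem i⟩, mem_univ _⟩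
  exact ⟨x, fun y => hx y (mem_univ _)⟩

lemma endStates_nonempty {n : ℕ} (hn : 0 < n) (G : SetCoveringGame n) (f : UtilityRule) (k : ℕ) :
    (G.endStates f k).Nonempty := by
  choose x hx using fun (i : Fin n) (a : G.Profile) => G.exists_isBestResponse f i a
  let agent (m : ℕ) : Fin n := ⟨m % n, Nat.mod_lt m hn⟩
  let σ : ℕ → G.Profile := fun m =>
    Nat.rec G.nullProfile (fun m a => Function.update a (agent m) (x (agent m) a)) m
  refine ⟨σ (k * n), σ, rfl, fun m _ i hi => ?_, rfl⟩
  obtain rfl : i = agent m := Fin.ext hi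
  have hs : σ (m + 1) = Function.update (σ m) (agent m) (x (agent m) (σ m)) := rfl
  rw [hs]
  refine ⟨?_, fun j hj => Function.update_of_ne hj _ _⟩
  rw [Function.update_self]
  exact hx _ _

lemma BestResponseStep.eq_update {n : ℕ} {G : SetCoveringGame n} {f : UtilityRule} {i : Fin n}
    {a b : G.Profile} (h : G.BestResponseStep f i a b) : b = Function.update a i (b i) := by
  ext1 j
  by_cases hj : j = i
  · subst hj; simp
  · rw [Function.update_of_ne hj, h.2 j hj]

/-! ### Passing between the infima and single games. -/

lemma welfare_le_optWelfare {n : ℕ} (G : SetCoveringGame n) (a : G.Profile) :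
    G.welfare a ≤ G.optWelfare :=
  le_csSup (Set.finite_range _).bddAbove ⟨a, rfl⟩

lemma exists_welfare_eq_optWelfare {n : ℕ} (G : SetCoveringGame n) :
    ∃ o, G.welfare o = G.optWelfare :=
  (Set.range_nonempty_iff_nonempty.2 ⟨G.nullProfile⟩).csSup_mem (Set.finite_range _)

lemma sInf_welfare_nonneg {n : ℕ} (G : SetCoveringGame n) (s : Set G.Profile) :
    0 ≤ sInf (G.welfare '' s) :=
  Real.sInf_nonneg (by rintro _ ⟨a, -, rfl⟩; exact G.welfare_nonneg a)

lemma sInf_welfare_div_le {n : ℕ} (G : SetCoveringGame n) {s : Set G.Profile} {a o : G.Profile}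
    (ha : a ∈ s) (ho : 0 < G.welfare o) :
    sInf (G.welfare '' s) / G.optWelfare ≤ G.welfare a / G.welfare o :=
  div_le_div₀ (G.welfare_nonneg a)
    (csInf_le ⟨0, by rintro _ ⟨a, -, rfl⟩; exact G.welfare_nonneg a⟩ ⟨a, ha, rfl⟩) ho
    (G.welfare_le_optWelfare o)

lemma le_sInf_welfare_div {n : ℕ} (G : SetCoveringGame n) {s : Set G.Profile} (hs : s.Nonempty)
    (hG : 0 < G.optWelfare) {c : ℝ} (h : ∀ a ∈ s, ∀ o, c * G.welfare o ≤ G.welfare a) :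
    c ≤ sInf (G.welfare '' s) / G.optWelfare := by
  rw [le_div_iff₀ hG]
  refine le_csInf (hs.image _) ?_
  rintro _ ⟨a, ha, rfl⟩
  obtain ⟨o, ho⟩ := G.exists_welfare_eq_optWelfare
  rw [← ho]
  exact h a ha o

/-- A game with positive optimal welfare. -/
def unitGame (n : ℕ) : SetCoveringGame n where
  Resource := Unit
  value _ := 1
  value_nonneg _ := zero_le_one
  actions _ := {∅, {()}}
  null_mem _ := by simp

lemma unitGame_optWelfare_pos (n : ℕ+) : 0 < (unitGame n).optWelfare := by
  refine lt_of_lt_of_le ?_ ((unitGame n).welfare_le_optWelfare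
    fun _ => ⟨({()} : Finset Unit), mem_insert_of_mem (mem_singleton_self _)⟩)
  rw [welfare_eq_sum]
  refine sum_pos (fun r _ => ?_) ⟨(), mem_univ ()⟩
  rw [if_pos ((count_pos_iff _ _ _).2 ⟨⟨0, n.pos⟩, mem_singleton_self _⟩)]
  exact zero_lt_one

end SetCoveringGame

open SetCoveringGame

lemma poaN_nonneg (f : UtilityRule) (n : ℕ) : 0 ≤ poaN f n :=
  Real.sInf_nonneg (by
    rintro _ ⟨G, hG, rfl⟩; exact div_nonneg (G.sInf_welfare_nonneg _) hG.le)

lemma pobN_nonneg (f : UtilityRule) (n k : ℕ) : 0 ≤ pobN f n k :=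
  Real.sInf_nonneg (by
    rintro _ ⟨G, hG, rfl⟩; exact div_nonneg (G.sInf_welfare_nonneg _) hG.le)

lemma pob_nonneg (f : UtilityRule) (k : ℕ) : 0 ≤ pob f k :=
  le_ciInf fun n => pobN_nonneg f n k

lemma poa_le_div {n : ℕ} (hn : 0 < n) (G : SetCoveringGame n) {f : UtilityRule}
    {a o : G.Profile} (ha : a ∈ G.nashEquilibria f) (ho : 0 < G.welfare o) :
    poa f ≤ G.welfare a / G.welfare o := by
  have h1 : BddBelow (Set.range fun m : ℕ+ => poaN f m) :=
    ⟨0, by rintro _ ⟨m, rfl⟩; exact poaN_nonneg f m⟩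
  have h2 : BddBelow {x | ∃ G : SetCoveringGame n, 0 < G.optWelfare ∧ x = G.priceOfAnarchy f} := by
    refine ⟨0, ?_⟩
    rintro _ ⟨G, hG, rfl⟩
    exact div_nonneg (G.sInf_welfare_nonneg _) hG.le
  have h3 : poaN f n ≤ G.priceOfAnarchy f :=
    csInf_le h2 ⟨G, ho.trans_le (G.welfare_le_optWelfare o), rfl⟩
  exact (ciInf_le h1 ⟨n, hn⟩).trans (h3.trans (G.sInf_welfare_div_le ha ho))

lemma pob_le_div {n k : ℕ} (hn : 0 < n) (G : SetCoveringGame n) {f : UtilityRule}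
    {a o : G.Profile} (ha : a ∈ G.endStates f k) (ho : 0 < G.welfare o) :
    pob f k ≤ G.welfare a / G.welfare o := by
  have h1 : BddBelow (Set.range fun m : ℕ+ => pobN f m k) :=
    ⟨0, by rintro _ ⟨m, rfl⟩; exact pobN_nonneg f m k⟩
  have h2 : BddBelow {x | ∃ G : SetCoveringGame n, 0 < G.optWelfare ∧ x = G.priceOfBestResponse f k} := by
    refine ⟨0, ?_⟩
    rintro _ ⟨G, hG, rfl⟩
    exact div_nonneg (G.sInf_welfare_nonneg _) hG.le
  have h3 : pobN f n k ≤ G.priceOfBestResponse f k :=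
    csInf_le h2 ⟨G, ho.trans_le (G.welfare_le_optWelfare o), rfl⟩
  exact (ciInf_le h1 ⟨n, hn⟩).trans (h3.trans (G.sInf_welfare_div_le ha ho))

lemma le_poa {f : UtilityRule} {c : ℝ}
    (h : ∀ (n : ℕ) (G : SetCoveringGame n), ∀ a ∈ G.nashEquilibria f, ∀ o,
      c * G.welfare o ≤ G.welfare a) : c ≤ poa f := by
  refine le_ciInf fun n => le_csInf ⟨_, unitGame n, unitGame_optWelfare_pos n, rfl⟩ ?_
  rintro _ ⟨G, hG, rfl⟩
  exact G.le_sInf_welfare_div (G.nashEquilibria_nonempty f) hG (h n G)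

lemma le_pob {f : UtilityRule} {k : ℕ} {c : ℝ}
    (h : ∀ (n : ℕ) (G : SetCoveringGame n), ∀ a ∈ G.endStates f k, ∀ o,
      c * G.welfare o ≤ G.welfare a) : c ≤ pob f k := by
  refine le_ciInf fun n => le_csInf ⟨_, unitGame n, unitGame_optWelfare_pos n, rfl⟩ ?_
  rintro _ ⟨G, hG, rfl⟩
  exact G.le_sInf_welfare_div (G.endStates_nonempty n.pos f k) hG (h n G)

/-! ### Guarantees valid in every game. -/

namespace SetCoveringGame

open Finset

lemma sum_utility {n : ℕ} (G : SetCoveringGame n) (f : UtilityRule) (a : G.Profile) :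
    ∑ i, G.utility f i a = ∑ r, G.value r * (G.count a r * (f (G.count a r) : ℝ)) := by
  simp_rw [utility_eq_sum]
  rw [sum_comm]
  refine sum_congr rfl fun r _ => ?_
  rw [← sum_filter, sum_const, nsmul_eq_mul]
  change (G.count a r : ℝ) * _ = _
  ring

/-- For a nonincreasing rule, a deviation towards `o` earns at least the multiplier
`f (count + 1)` on every resource of `o`. -/
lemma sum_le_sum_utility_update {n : ℕ} (G : SetCoveringGame n) {f : UtilityRule}
    (hf : ∀ j, 1 ≤ j → f (j + 1) ≤ f j) (a o : G.Profile) :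
    ∑ r, (if 0 < G.count o r then G.value r * (f (G.count a r + 1) : ℝ) else 0) ≤
      ∑ i, G.utility f i (Function.update a i (o i)) := by
  simp_rw [utility_eq_sum]
  rw [sum_comm]
  refine sum_le_sum fun r _ => ?_
  have hpos : ∀ i, 0 ≤ if r ∈ (Function.update a i (o i) i).1 then
      G.value r * (f (G.count (Function.update a i (o i)) r) : ℝ) else 0 := fun i => by
    split_ifs
    exacts [mul_nonneg (G.value_nonneg r) (f _).2, le_rfl]
  split_ifs with h
  · obtain ⟨i, hi⟩ := (count_pos_iff _ _ _).1 h
    refine le_trans ?_ (single_le_sum (fun j _ => hpos j) (mem_univ i))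
    have h1 := count_update_eq_add G a i (o i) r
    have h2 := count_update_eq_add G a i (a i) r
    rw [Function.update_eq_self] at h2
    rw [if_pos hi] at h1
    rw [Function.update_self, if_pos hi]
    refine mul_le_mul_of_nonneg_left ?_ (G.value_nonneg r)
    rw [h1, h2, NNReal.coe_le_coe]
    -- If agent `i` already covers `r` in `a`, the deviation leaves the count unchanged, and
    -- monotonicity is needed; otherwise the count rises by exactly one.
    split_ifs
    · exact hf _ (by omega)
    · exact le_rfl
  · exact sum_nonneg fun i _ => hpos i

/-- Smoothness: summing the equilibrium inequalities against deviations to `o` reduces the claim to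
an inequality at each resource. -/
lemma welfare_le_of_mem_nashEquilibria {n : ℕ} (G : SetCoveringGame n) {f : UtilityRule} {χ : ℝ}
    (h1 : f 1 = 1) (hf : ∀ j, 1 ≤ j → f (j + 1) ≤ f j)
    (hχ : ∀ j : ℕ, 1 ≤ j → (j : ℝ) * f j - f (j + 1) ≤ χ) {a : G.Profile}
    (ha : a ∈ G.nashEquilibria f) (o : G.Profile) :
    G.welfare o ≤ (1 + χ) * G.welfare a := by
  have hle : ∑ i, G.utility f i (Function.update a i (o i)) ≤ ∑ i, G.utility f i a :=
    sum_le_sum fun i _ => by simpa using ha i (o i)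
  have hf1 : ∀ j, 1 ≤ j → (f j : ℝ) ≤ 1 := fun j hj => by
    induction j, hj using Nat.le_induction with
    | base => simp [h1]
    | succ j hj ih => exact le_trans (by exact_mod_cast hf j hj) ih
  have hr : ∀ r, (if 0 < G.count o r then G.value r else 0) +
      G.value r * (G.count a r * (f (G.count a r) : ℝ)) ≤
      (1 + χ) * (if 0 < G.count a r then G.value r else 0) +
      (if 0 < G.count o r then G.value r * (f (G.count a r + 1) : ℝ) else 0) := fun r => by
    have hv := G.value_nonneg r
    rcases Nat.eq_zero_or_pos (G.count a r) with h0 | h0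
    · by_cases ho : 0 < G.count o r <;> simp [h0, ho, h1]
    · have e1 := hχ _ h0
      have e2 := hf1 (G.count a r + 1) (by omega)
      by_cases ho : 0 < G.count o r
      · simp only [ho, h0, if_true]
        nlinarith [mul_le_mul_of_nonneg_left e1 hv]
      · simp only [ho, h0, if_true, if_false]
        nlinarith [mul_le_mul_of_nonneg_left (e1.trans' (sub_le_sub_left e2 _)) hv]
  have hs := sum_le_sum fun r (_ : r ∈ univ) => hr r
  rw [sum_add_distrib, sum_add_distrib, ← mul_sum, ← welfare_eq_sum, ← welfare_eq_sum,
    ← sum_utility] at hs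
  linarith [G.sum_le_sum_utility_update hf a o]

lemma potential_le {n : ℕ} (G : SetCoveringGame n) {f : UtilityRule} {S : ℝ}
    (hS : ∀ m, ∑ k ∈ range m, (f (k + 1) : ℝ) ≤ S) (a : G.Profile) :
    G.potential f a ≤ S * G.welfare a := by
  rw [potential, welfare_eq_sum, mul_sum]
  refine sum_le_sum fun r _ => ?_
  split_ifs with h
  · rw [mul_comm S]
    exact mul_le_mul_of_nonneg_left (hS _) (G.value_nonneg r)
  · simp [Nat.eq_zero_of_not_pos h]

lemma potential_nullProfile {n : ℕ} (G : SetCoveringGame n) (f : UtilityRule) :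
    G.potential f G.nullProfile = 0 := by
  simp [potential, count, nullProfile]

/-- The utilities earned at the moments of moving telescope to the potential of `a`, at most `S *
W(a)`. Each is at least the value of the part of `o i` that `a` leaves uncovered, so these utilities
pay for `W(o) - W(a)`. -/
lemma welfare_le_of_mem_endStates {n : ℕ} (G : SetCoveringGame n) {f : UtilityRule} {S : ℝ}
    (h1 : f 1 = 1) (hS : ∀ m, ∑ k ∈ range m, (f (k + 1) : ℝ) ≤ S) {a : G.Profile}
    (ha : a ∈ G.endStates f 1) (o : G.Profile) :
    G.welfare o ≤ (S + 1) * G.welfare a := by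
  obtain ⟨σ, h0, hstep, hend⟩ := ha
  rw [one_mul] at hstep hend
  -- In one round each agent moves once: it is null before its turn and final after it, so the
  -- covered set only grows towards that of `a`.
  have step : ∀ i : Fin n, G.BestResponseStep f i (σ i) (σ (i + 1)) := fun i =>
    hstep i i.2 i (Nat.mod_eq_of_lt i.2).symm
  have later : ∀ m, m ≤ n → ∀ i : Fin n, m ≤ i → σ m i = G.nullProfile i := fun m => by
    induction m with
    | zero => intro _ i _; rw [h0]
    | succ m ih =>
      intro hm i hi
      have hne : i ≠ ⟨m, hm⟩ := fun h => by rw [h] at hi; simp at hi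
      rw [(step ⟨m, hm⟩).2 i hne]
      exact ih (by omega) i (by omega)
  have earlier : ∀ (i : Fin n) m, i.1 + 1 ≤ m → m ≤ n → σ m i = σ (i + 1) i := fun i m hm => by
    induction m, hm using Nat.le_induction with
    | base => intro _; rfl
    | succ m hm ih =>
      intro hmn
      have hne : i ≠ ⟨m, hmn⟩ := fun h => by rw [h] at hm; simp at hm
      rw [(step ⟨m, hmn⟩).2 i hne, ih (by omega)]
  have hsub : ∀ m, m ≤ n → ∀ i, (σ m i).1 ⊆ (a i).1 := fun m hm i => by
    rcases Nat.lt_or_ge i.1 m with h | h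
    · rw [earlier i m h hm, ← earlier i n i.2 le_rfl, hend]
    · rw [later m hm i h]; exact empty_subset _
  have hcount : ∀ m, m ≤ n → ∀ r, G.count a r = 0 → ∀ i, r ∉ (σ m i).1 := fun m hm r hr i hi =>
    (((count_pos_iff _ _ _).2 ⟨i, hsub m hm i hi⟩).ne') hr
  have hpot : ∀ i : Fin n, G.potential f (σ (i + 1)) - G.potential f (σ i) =
      G.utility f i (σ (i + 1)) := fun i => by
    have e := potential_update G f (σ i) i (σ (i + 1) i)
    have e2 : Function.update (σ i) i ⟨∅, G.null_mem i⟩ = σ i :=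
      (Function.update_eq_iff).2 ⟨(later i i.2.le i le_rfl).symm, fun _ _ => rfl⟩
    rw [← (step i).eq_update, e2] at e
    linarith
  have htel : ∑ i : Fin n, G.utility f i (σ (i + 1)) = G.potential f a := by
    simp_rw [← hpot]
    rw [Fin.sum_univ_eq_sum_range (fun m => G.potential f (σ (m + 1)) - G.potential f (σ m)),
      sum_range_sub (fun m => G.potential f (σ m)), hend, h0, potential_nullProfile, sub_zero]
  have hdev : ∀ i : Fin n, ∑ r, (if r ∈ (o i).1 ∧ G.count a r = 0 then G.value r else 0) ≤
      G.utility f i (σ (i + 1)) := fun i => by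
    have hb := (step i).1 (o i)
    rw [← (step i).eq_update] at hb
    refine le_trans ?_ hb
    rw [utility_eq_sum]
    refine sum_le_sum fun r _ => ?_
    rw [Function.update_self]
    by_cases hr : r ∈ (o i).1
    · by_cases hc : G.count a r = 0
      -- A resource uncovered at the end was uncovered throughout, so agent `i` would be alone on it
      -- and earn its full value.
      · have : G.count (Function.update (σ i) i (o i)) r = 1 := by
          rw [count_update, if_pos hr, add_eq_right, card_eq_zero]
          exact filter_eq_empty_iff.2 fun j _ hj => hcount i i.2.le r hc j hj.2
        simp [hr, hc, this, h1]
      · simp only [hr, hc, and_false, if_false, if_true]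
        exact mul_nonneg (G.value_nonneg r) (f _).2
    · simp [hr]
  have hopt : G.welfare o - G.welfare a ≤
      ∑ i, ∑ r, (if r ∈ (o i).1 ∧ G.count a r = 0 then G.value r else 0) := by
    rw [sum_comm, welfare_eq_sum, welfare_eq_sum, ← sum_sub_distrib]
    refine sum_le_sum fun r _ => ?_
    have hv := G.value_nonneg r
    have hpos : ∀ i, 0 ≤ if r ∈ (o i).1 ∧ G.count a r = 0 then G.value r else 0 := fun i => by
      split_ifs
      exacts [hv, le_rfl]
    by_cases hc : G.count a r = 0
    · by_cases ho : 0 < G.count o r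
      · obtain ⟨i, hi⟩ := (count_pos_iff _ _ _).1 ho
        refine le_trans ?_ (single_le_sum (fun j _ => hpos j) (mem_univ i))
        simp [hc, hi, ho]
      · refine le_trans ?_ (sum_nonneg fun i _ => hpos i)
        simp [hc, ho]
    · refine le_trans ?_ (sum_nonneg fun i _ => hpos i)
      rw [if_pos (Nat.pos_of_ne_zero hc)]
      split_ifs <;> linarith
  have hsum := sum_le_sum fun i (_ : i ∈ univ) => hdev i
  linarith [G.potential_le hS a]

end SetCoveringGame

/-! ### Worst-case games. -/

namespace SetCoveringGame

open Finset

/-- Agent `i` may cover all common resources but the `i`-th, or the `i`-th common resource together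
with a private resource of value `θ`. -/
abbrev cyclicGame (n : ℕ) (θ : ℝ≥0) : SetCoveringGame n where
  Resource := Fin n ⊕ Fin n
  value := Sum.elim (fun _ => 1) fun _ => θ
  value_nonneg r := by cases r <;> simp
  actions i := {∅, (univ.erase i).disjSum ∅, ({i} : Finset (Fin n)).disjSum {i}}
  null_mem i := by simp

lemma mem_actions_cyclicGame {n : ℕ} {θ : ℝ≥0} {i : Fin n} {s : Finset (Fin n ⊕ Fin n)} :
    s ∈ (cyclicGame n θ).actions i ↔
      s = ∅ ∨ s = (univ.erase i).disjSum ∅ ∨ s = ({i} : Finset (Fin n)).disjSum {i} := by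
  change s ∈ ({_, _, _} : Finset (Finset (Fin n ⊕ Fin n))) ↔ _
  rw [mem_insert, mem_insert, mem_singleton]

/-- The profile of `cyclicGame` without private resources. -/
def cyclicNash (n : ℕ) (θ : ℝ≥0) : (cyclicGame n θ).Profile :=
  fun i => ⟨(univ.erase i).disjSum ∅, mem_actions_cyclicGame.2 (.inr (.inl rfl))⟩

/-- The profile of `cyclicGame` covering everything. -/
def cyclicOpt (n : ℕ) (θ : ℝ≥0) : (cyclicGame n θ).Profile :=
  fun i => ⟨({i} : Finset (Fin n)).disjSum {i}, mem_actions_cyclicGame.2 (.inr (.inr rfl))⟩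

lemma welfare_cyclicOpt (n : ℕ) (θ : ℝ≥0) :
    (cyclicGame n θ).welfare (cyclicOpt n θ) = n * (1 + θ) := by
  have h : ∀ r, 0 < (cyclicGame n θ).count (cyclicOpt n θ) r := fun r => by
    rw [count_pos_iff]
    rcases r with k | k
    · exact ⟨k, inl_mem_disjSum.2 (mem_singleton_self k)⟩
    · exact ⟨k, inr_mem_disjSum.2 (mem_singleton_self k)⟩
  rw [welfare_eq_sum]
  simp_rw [h, if_true]
  rw [show (∑ r, (cyclicGame n θ).value r) =
    ∑ r : Fin n ⊕ Fin n, Sum.elim (fun _ => (1 : ℝ)) (fun _ => (θ : ℝ)) r from rfl]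
  simp
  ring

lemma welfare_cyclicNash_le (n : ℕ) (θ : ℝ≥0) :
    (cyclicGame n θ).welfare (cyclicNash n θ) ≤ n := by
  rw [welfare_eq_sum]
  have h : ∀ k : Fin n, ¬ 0 < (cyclicGame n θ).count (cyclicNash n θ) (Sum.inr k) := fun k => by
    rw [count_pos_iff]
    rintro ⟨i, hi⟩
    exact notMem_empty _ (inr_mem_disjSum.1 hi)
  refine (Fintype.sum_sum_type _).trans_le ?_
  simp_rw [h, if_false, sum_const_zero, add_zero]
  refine (sum_le_card_nsmul _ _ 1 fun k _ => ?_).trans (by simp)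
  split_ifs
  exacts [le_rfl, zero_le_one]

/-- With `j + 1` agents every common resource is shared by `j` of them, so staying earns `j * f j`,
while the alternative makes one common resource shared by all and adds a private one. -/
lemma cyclicNash_mem_nashEquilibria {j : ℕ} {f : UtilityRule} {θ : ℝ≥0}
    (h : f (j + 1) + θ * f 1 ≤ j * f j) :
    cyclicNash (j + 1) θ ∈ (cyclicGame (j + 1) θ).nashEquilibria f := by
  intro i y
  have hcount : ∀ k, (cyclicGame (j + 1) θ).count (cyclicNash (j + 1) θ) (Sum.inl k) = j :=
    fun k => by
      have : (univ.filter fun i : Fin (j + 1) =>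
          (Sum.inl k : Fin (j + 1) ⊕ Fin (j + 1)) ∈ (univ.erase i).disjSum ∅) = univ.erase k := by
        ext i; simp [eq_comm]
      exact (congrArg card this).trans (by simp)
  have hN : (cyclicGame (j + 1) θ).utility f i (cyclicNash (j + 1) θ) = j * f j := by
    refine (sum_disjSum (univ.erase i) ∅ _).trans ?_
    simp_rw [hcount]
    simp [cyclicGame]
  rw [Function.update_eq_self, hN]
  obtain ⟨y, hy⟩ := y
  rcases mem_actions_cyclicGame.1 hy with rfl | rfl | rfl
  · simp only [utility, Function.update_self, sum_empty]
    positivity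
  · rw [← hN]
    exact (congrArg _ (Function.update_eq_self i (cyclicNash (j + 1) θ))).le
  · have hl : (cyclicGame (j + 1) θ).count (Function.update (cyclicNash (j + 1) θ) i
        ⟨({i} : Finset (Fin (j + 1))).disjSum {i}, hy⟩) (Sum.inl i) = j + 1 := by
      rw [count_update]
      have : (univ.filter fun k : Fin (j + 1) => k ≠ i ∧
          (Sum.inl i : Fin (j + 1) ⊕ Fin (j + 1)) ∈ (univ.erase k).disjSum ∅) = univ.erase i := by
        ext k; simp [eq_comm]
      refine congrArg₂ (· + ·) ((congrArg card this).trans (by simp)) ?_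
      exact if_pos (inl_mem_disjSum.2 (mem_singleton_self i))
    have hr : (cyclicGame (j + 1) θ).count (Function.update (cyclicNash (j + 1) θ) i
        ⟨({i} : Finset (Fin (j + 1))).disjSum {i}, hy⟩) (Sum.inr i) = 1 := by
      rw [count_update]
      have : (univ.filter fun k : Fin (j + 1) => k ≠ i ∧
          (Sum.inr i : Fin (j + 1) ⊕ Fin (j + 1)) ∈ (univ.erase k).disjSum ∅) = ∅ := by
        ext k; simp
      refine (congrArg₂ (· + ·) ((congrArg card this).trans card_empty) ?_).trans (zero_add 1)
      exact if_pos (inr_mem_disjSum.2 (mem_singleton_self i))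
    rw [utility, Function.update_self]
    refine (sum_disjSum {i} {i} _).trans_le ?_
    rw [sum_singleton, sum_singleton, hl, hr]
    simpa [cyclicGame] using (show (f (j + 1) + θ * f 1 : ℝ) ≤ j * f j by exact_mod_cast h)

/-- All agents may cover a common resource of value one, and agent `i` may instead cover a private
resource of value `w i`. -/
abbrev commonGame (n : ℕ) (w : ℕ → ℝ≥0) : SetCoveringGame n where
  Resource := Option (Fin n)
  value r := r.elim 1 fun i => w i
  value_nonneg r := by cases r <;> simp
  actions i := {∅, {none}, {some i}}
  null_mem i := by simp

lemma mem_actions_commonGame {n : ℕ} {w : ℕ → ℝ≥0} {i : Fin n} {s : Finset (Option (Fin n))} :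
    s ∈ (commonGame n w).actions i ↔ s = ∅ ∨ s = {none} ∨ s = {some i} := by
  change s ∈ ({_, _, _} : Finset (Finset (Option (Fin n)))) ↔ _
  rw [mem_insert, mem_insert, mem_singleton]

/-- The profile of `commonGame` in which the first `m` agents cover the common resource. -/
def commonProfile (n : ℕ) (w : ℕ → ℝ≥0) (m : ℕ) : (commonGame n w).Profile :=
  fun i => if i.1 < m then
    ⟨{none}, mem_actions_commonGame.2 (.inr (.inl rfl))⟩
  else ⟨∅, (commonGame n w).null_mem i⟩

/-- The profile of `commonGame` in which only the last agent covers the common resource. -/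
def commonOpt (n : ℕ) (w : ℕ → ℝ≥0) : (commonGame (n + 1) w).Profile :=
  fun i => if i.1 < n then
    ⟨{some i}, mem_actions_commonGame.2 (.inr (.inr rfl))⟩
  else ⟨{none}, mem_actions_commonGame.2 (.inr (.inl rfl))⟩

lemma welfare_commonProfile_le (n : ℕ) (w : ℕ → ℝ≥0) (m : ℕ) :
    (commonGame n w).welfare (commonProfile n w m) ≤ 1 := by
  refine (sum_le_sum_of_subset_of_nonneg (t := {(none : Option (Fin n))}) ?_
    fun r _ _ => (commonGame n w).value_nonneg r).trans ?_
  · intro r hr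
    obtain ⟨i, -, hi⟩ := mem_biUnion.1 hr
    unfold commonProfile at hi
    split_ifs at hi
    · exact hi
    · exact absurd hi (notMem_empty r)
  · exact (sum_singleton _ _).le

lemma le_welfare_commonOpt (n : ℕ) (w : ℕ → ℝ≥0) :
    1 + ∑ i ∈ range n, (w i : ℝ) ≤ (commonGame (n + 1) w).welfare (commonOpt n w) := by
  rw [welfare_eq_sum]
  refine le_trans ?_ (Fintype.sum_option _).ge
  refine add_le_add ?_ ?_
  · rw [if_pos]
    · exact le_rfl
    · refine (count_pos_iff _ _ _).2 ⟨Fin.last n, ?_⟩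
      unfold commonOpt
      rw [if_neg (by simp)]
      exact mem_singleton_self _
  · refine le_trans ?_ (Fin.sum_univ_castSucc _).ge
    refine le_add_of_le_of_nonneg ?_ ?_
    · rw [← Fin.sum_univ_eq_sum_range fun i => (w i : ℝ)]
      refine sum_le_sum fun i _ => ?_
      rw [if_pos]
      · exact le_rfl
      · refine (count_pos_iff _ _ _).2 ⟨i.castSucc, ?_⟩
        unfold commonOpt
        rw [if_pos (by simp)]
        exact mem_singleton_self _
    · split_ifs
      exacts [(commonGame (n + 1) w).value_nonneg _, le_rfl]

/-- The weights make each mover indifferent between its private resource and joining the common one;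
ties are broken towards the latter. -/
lemma commonProfile_mem_endStates {n : ℕ} {f : UtilityRule} {w : ℕ → ℝ≥0}
    (hw : ∀ i, w i * f 1 = f (i + 1)) :
    commonProfile n w n ∈ (commonGame n w).endStates f 1 := by
  refine ⟨commonProfile n w, rfl, fun m hm i hi => ?_, by rw [one_mul]⟩
  rw [one_mul] at hm
  rw [Nat.mod_eq_of_lt hm] at hi
  subst hi
  have hmem : (commonProfile n w (i + 1) i) = ⟨{none}, mem_actions_commonGame.2 (.inr (.inl rfl))⟩ :=
    if_pos (Nat.lt_succ_self _)
  have hnone : ∀ y : {s // s ∈ (commonGame n w).actions i}, none ∈ y.1 →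
      (commonGame n w).count (Function.update (commonProfile n w i) i y) none = i + 1 :=
    fun y hy => by
      rw [count_update, if_pos hy]
      have : (univ.filter fun k : Fin n => k ≠ i ∧
          (none : Option (Fin n)) ∈ (commonProfile n w i k).1) = Iio i := by
        ext k
        simp only [mem_filter, mem_univ, true_and, mem_Iio, commonProfile]
        by_cases hk : k < i
        · simp [hk, hk.ne]
        · simp [hk]
      exact congrArg (· + 1) ((congrArg card this).trans (Fin.card_Iio i))
  have hu : (commonGame n w).utility f i (Function.update (commonProfile n w i) i
      ⟨{none}, mem_actions_commonGame.2 (.inr (.inl rfl))⟩) = f (i + 1) := by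
    rw [utility, Function.update_self]
    refine (sum_singleton _ _).trans ?_
    rw [hnone _ (mem_singleton_self _)]
    exact one_mul _
  refine ⟨?_, fun k hk => ?_⟩
  · rw [hmem]
    rintro ⟨y, hy⟩
    rw [hu]
    rcases mem_actions_commonGame.1 hy with rfl | rfl | rfl
    · simp [utility]
    · exact hu.le
    · rw [utility, Function.update_self]
      refine (sum_singleton _ _).trans_le ?_
      have : (commonGame n w).count (Function.update (commonProfile n w i) i ⟨{some i}, hy⟩)
          (some i) = 1 := by
        rw [count_update, if_pos (mem_singleton_self _)]
        refine congrArg (· + 1) (card_eq_zero.2 (filter_eq_empty_iff.2 ?_))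
        rintro k - ⟨-, hk⟩
        unfold commonProfile at hk
        split_ifs at hk
        · simp at hk
        · exact notMem_empty _ hk
      rw [this]
      exact_mod_cast (hw i).le
  · unfold commonProfile
    have : k.1 ≠ i.1 := fun h => hk (Fin.ext h)
    simp only [show (k.1 < i.1 + 1) = (k.1 < i.1) by rw [eq_iff_iff]; omega]

end SetCoveringGame

/-! ### Constraints on a rule from the worst-case games. -/

lemma poa_le_inv_one_add {f : UtilityRule} {j : ℕ} {θ : ℝ≥0}
    (h : f (j + 1) + θ * f 1 ≤ j * f j) : poa f ≤ (1 + (θ : ℝ))⁻¹ := by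
  have hj : (0 : ℝ) < ((j + 1 : ℕ) : ℝ) := by positivity
  have hw := welfare_cyclicOpt (j + 1) θ
  refine (poa_le_div (Nat.succ_pos j) _ (cyclicNash_mem_nashEquilibria h)
    (o := cyclicOpt (j + 1) θ) (by rw [hw]; positivity)).trans ?_
  rw [hw, div_le_iff₀ (by positivity), mul_comm _ (1 + (θ : ℝ)),
    inv_mul_cancel_left₀ (by positivity)]
  exact welfare_cyclicNash_le (j + 1) θ

lemma mul_sub_le_of_poa_eq {f : UtilityRule} {C : ℝ} (hC : 0 < C) (hC1 : C ≤ 1) (hf : poa f = C)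
    (h1 : f 1 ≠ 0) (j : ℕ) : (j : ℝ) * f j - f (j + 1) ≤ (1 - C) / C * f 1 := by
  have hpos : (0 : ℝ) < f 1 := NNReal.coe_pos.2 (pos_iff_ne_zero.2 h1)
  rcases le_total ((j : ℝ) * f j) (f (j + 1)) with h | h
  · exact (sub_nonpos.2 h).trans (mul_nonneg (div_nonneg (by linarith) hC.le) hpos.le)
  · have hθ : (0 : ℝ) ≤ ((j : ℝ) * f j - f (j + 1)) / f 1 := div_nonneg (by linarith) hpos.le
    -- The largest private value for which the bad profile is still an equilibrium.
    obtain ⟨θ, hθ⟩ : ∃ θ : ℝ≥0, (θ : ℝ) = ((j : ℝ) * f j - f (j + 1)) / f 1 := ⟨⟨_, hθ⟩, rfl⟩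
    have hθ2 : (θ : ℝ) * f 1 = j * f j - f (j + 1) := by rw [hθ, div_mul_cancel₀ _ hpos.ne']
    have h2 := poa_le_inv_one_add (f := f) (j := j) (θ := θ) (by
      rw [← NNReal.coe_le_coe]; push_cast; linarith)
    rw [hf, le_inv_comm₀ hC (by positivity)] at h2
    rw [← hθ2]
    refine mul_le_mul_of_nonneg_right ?_ hpos.le
    rw [sub_div, div_self hC.ne', one_div]
    linarith

lemma poa_eq_zero_of_apply_one {f : UtilityRule} (h1 : f 1 = 0) : poa f = 0 := by
  refine le_antisymm ?_ (le_ciInf fun n => poaN_nonneg f n)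
  by_contra! hpos
  -- With `j = 0` there is one agent, who earns nothing anywhere, so `θ` is arbitrary; this choice
  -- gives 1 + 1/PoA ≤ 1/PoA.
  have h := poa_le_inv_one_add (f := f) (j := 0) (θ := (poa f)⁻¹.toNNReal) (by simp [h1])
  rw [Real.coe_toNNReal _ (by positivity), le_inv_comm₀ hpos (by positivity)] at h
  linarith

lemma pob_le_inv {f : UtilityRule} (h1 : f 1 ≠ 0) (n : ℕ) :
    pob f 1 ≤ (1 + ∑ i ∈ Finset.range n, (f (i + 1) : ℝ) / f 1)⁻¹ := by
  have hw : ∀ i, f (i + 1) / f 1 * f 1 = f (i + 1) := fun i => div_mul_cancel₀ _ h1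
  have h := le_welfare_commonOpt n fun i => f (i + 1) / f 1
  push_cast at h
  have hpos : 0 < 1 + ∑ i ∈ Finset.range n, (f (i + 1) : ℝ) / f 1 :=
    add_pos_of_pos_of_nonneg one_pos (Finset.sum_nonneg fun i _ => by positivity)
  refine (pob_le_div (Nat.succ_pos n) _ (commonProfile_mem_endStates hw)
    (hpos.trans_le h)).trans ?_
  rw [← one_div]
  exact div_le_div₀ zero_le_one (welfare_commonProfile_le _ _ _) hpos h

/-! ### The extremal sequence. -/

/-- The `j`-th term of the series in `optimalPob`, with `χ = (1 - C) / C`. -/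
noncomputable def tradeoffTerm (χ : ℝ) (j : ℕ) : ℝ :=
  max ((j.factorial : ℝ) * (1 - χ * ∑ τ ∈ Finset.Icc 1 j, 1 / (τ.factorial : ℝ))) 0

lemma tradeoffTerm_nonneg (χ : ℝ) (j : ℕ) : 0 ≤ tradeoffTerm χ j := le_max_right _ _

lemma tradeoffTerm_zero (χ : ℝ) : tradeoffTerm χ 0 = 1 := by simp [tradeoffTerm]

lemma tradeoffTerm_succ {χ : ℝ} (hχ : 0 ≤ χ) (j : ℕ) :
    tradeoffTerm χ (j + 1) = max ((j + 1) * tradeoffTerm χ j - χ) 0 := by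
  have hj : (j.factorial : ℝ) ≠ 0 := by positivity
  have h : (((j + 1).factorial : ℕ) : ℝ) *
      (1 - χ * ∑ τ ∈ Finset.Icc 1 (j + 1), 1 / (τ.factorial : ℝ)) =
      (j + 1) * ((j.factorial : ℝ) * (1 - χ * ∑ τ ∈ Finset.Icc 1 j, 1 / (τ.factorial : ℝ))) -
        χ := by
    rw [Finset.sum_Icc_succ_top (by omega), Nat.factorial_succ]
    push_cast
    field_simp
    ring
  rw [tradeoffTerm, h, tradeoffTerm]
  -- Truncation commutes with the recursion: once the untruncated term is nonpositive, so is the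
  -- next one, as `χ ≥ 0`.
  rcases le_total 0 ((j.factorial : ℝ) *
    (1 - χ * ∑ τ ∈ Finset.Icc 1 j, 1 / (τ.factorial : ℝ))) with h0 | h0
  · rw [max_eq_left h0]
  · rw [max_eq_right h0, max_eq_right, max_eq_right]
    · linarith
    · nlinarith

lemma sum_range_succ_inv_factorial (j : ℕ) :
    ∑ m ∈ Finset.range (j + 1), (1 : ℝ) ^ m / (m.factorial : ℝ) =
      1 + ∑ τ ∈ Finset.Icc 1 j, 1 / (τ.factorial : ℝ) := by
  induction j with
  | zero => simp
  | succ j ih =>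
    rw [Finset.sum_range_succ, ih, Finset.sum_Icc_succ_top (by omega), one_pow, add_assoc]

/-- Since 1 ≤ χ(e - 1), the factor 1 - χs is at most χ times the tail of the series for e, which is
at most (j+2)/((j+1)!(j+1)). By the recursion this bound is what makes the sequence nonincreasing.
-/
lemma mul_tradeoffTerm_le {χ : ℝ} (hχ : 1 / (Real.exp 1 - 1) ≤ χ) (j : ℕ) :
    j * tradeoffTerm χ j ≤ χ := by
  have he : 0 < Real.exp 1 - 1 := by linarith [Real.add_one_lt_exp one_ne_zero]
  have hχ0 : 0 ≤ χ := le_trans (by positivity) hχ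
  have hb := Real.exp_bound' zero_le_one le_rfl (n := j + 1) (by omega)
  rw [sum_range_succ_inv_factorial, one_pow] at hb
  rw [div_le_iff₀ he] at hχ
  have hj : (0 : ℝ) < j.factorial := by positivity
  rw [tradeoffTerm, mul_max_of_nonneg _ _ j.cast_nonneg, mul_zero, max_le_iff]
  refine ⟨?_, hχ0⟩
  set s := ∑ τ ∈ Finset.Icc 1 j, 1 / (τ.factorial : ℝ)
  have h1 : 1 - χ * s ≤ χ * (1 * ((j + 1 : ℕ) + 1) / ((j + 1).factorial * (j + 1 : ℕ))) := by
    nlinarith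
  calc (j : ℝ) * (j.factorial * (1 - χ * s))
      ≤ j * (j.factorial *
        (χ * (1 * ((j + 1 : ℕ) + 1) / ((j + 1).factorial * (j + 1 : ℕ))))) := by gcongr
    _ = χ * (j * (j + 2) / (j + 1) ^ 2) := by
        rw [Nat.factorial_succ]; push_cast; field_simp; ring
    _ ≤ χ * 1 := by
        refine mul_le_mul_of_nonneg_left ?_ hχ0
        rw [div_le_one (by positivity)]
        nlinarith
    _ = χ := mul_one χ

lemma tradeoffTerm_succ_le {χ : ℝ} (hχ : 1 / (Real.exp 1 - 1) ≤ χ) (j : ℕ) :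
    tradeoffTerm χ (j + 1) ≤ tradeoffTerm χ j := by
  have he : 0 < Real.exp 1 - 1 := by linarith [Real.add_one_lt_exp one_ne_zero]
  rw [tradeoffTerm_succ (le_trans (by positivity) hχ), max_le_iff]
  exact ⟨by linarith [mul_tradeoffTerm_le hχ j], tradeoffTerm_nonneg _ _⟩

/-- Here (e - 1) t_j is at least j! times the tail of the series for e, whose first term 1/(j+1)!
already contributes 1/(j+1). -/
lemma not_summable_tradeoffTerm : ¬ Summable (tradeoffTerm (1 / (Real.exp 1 - 1))) := by
  have he : 0 < Real.exp 1 - 1 := by linarith [Real.add_one_lt_exp one_ne_zero]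
  intro h
  refine Real.not_summable_one_div_natCast ((summable_nat_add_iff 1).1 ?_)
  refine Summable.of_nonneg_of_le (fun j => by positivity) (fun j => ?_)
    (h.mul_left (Real.exp 1 - 1))
  have hb := Real.sum_le_exp_of_nonneg zero_le_one (j + 2)
  rw [sum_range_succ_inv_factorial, Finset.sum_Icc_succ_top (by omega)] at hb
  have hj : (0 : ℝ) < j.factorial := by positivity
  refine le_trans ?_ (mul_le_mul_of_nonneg_left (le_max_left _ _) he.le)
  set s := ∑ τ ∈ Finset.Icc 1 j, 1 / (τ.factorial : ℝ)
  calc 1 / ((j + 1 : ℕ) : ℝ) = j.factorial * (1 / ((j + 1).factorial : ℝ)) := by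
        rw [Nat.factorial_succ]; push_cast; field_simp
    _ ≤ j.factorial * (Real.exp 1 - 1 - s) := by gcongr; linarith
    _ = _ := by field_simp

lemma optimalPob_eq_of_summable {C : ℝ} (h : Summable (tradeoffTerm ((1 - C) / C))) :
    optimalPob C = (1 + ∑' j, tradeoffTerm ((1 - C) / C) j)⁻¹ := by
  have h0 : 0 ≤ ∑' j, tradeoffTerm ((1 - C) / C) j := tsum_nonneg (tradeoffTerm_nonneg _)
  have e : optimalPob C =
    (((∑' j : ℕ, ENNReal.ofReal (tradeoffTerm ((1 - C) / C) j)) + 1 : ℝ≥0∞)⁻¹).toReal := rfl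
  rw [e, ← ENNReal.ofReal_tsum_of_nonneg (tradeoffTerm_nonneg _) h, ENNReal.toReal_inv,
    ENNReal.toReal_add ENNReal.ofReal_ne_top ENNReal.one_ne_top, ENNReal.toReal_ofReal h0,
    ENNReal.toReal_one, add_comm]

lemma optimalPob_eq_zero_of_not_summable {C : ℝ}
    (h : ¬ Summable (tradeoffTerm ((1 - C) / C))) : optimalPob C = 0 := by
  have e : optimalPob C =
    (((∑' j : ℕ, ENNReal.ofReal (tradeoffTerm ((1 - C) / C) j)) + 1 : ℝ≥0∞)⁻¹).toReal := rfl
  have ht : ∑' j : ℕ, ENNReal.ofReal (tradeoffTerm ((1 - C) / C) j) = ⊤ := by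
    by_contra hne
    refine h ((ENNReal.summable_toReal hne).congr fun j => ?_)
    exact ENNReal.toReal_ofReal (tradeoffTerm_nonneg _ _)
  simp [e, ht]

/-! ### Optimality of the curve and the rule attaining it. -/

lemma tradeoffTerm_le_div {f : UtilityRule} {C : ℝ} (hC : 0 < C) (hC1 : C ≤ 1) (hf : poa f = C)
    (h1 : f 1 ≠ 0) (j : ℕ) : tradeoffTerm ((1 - C) / C) j ≤ f (j + 1) / f 1 := by
  have hpos : (0 : ℝ) < f 1 := NNReal.coe_pos.2 (pos_iff_ne_zero.2 h1)
  induction j with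
  | zero => rw [tradeoffTerm_zero, zero_add, div_self hpos.ne']
  | succ j ih =>
    rw [tradeoffTerm_succ (div_nonneg (by linarith) hC.le), max_le_iff]
    refine ⟨?_, by positivity⟩
    have h := mul_sub_le_of_poa_eq hC hC1 hf h1 (j + 1)
    rw [le_div_iff₀ hpos] at ih ⊢
    push_cast at h
    nlinarith

lemma pob_le_optimalPob {f : UtilityRule} {C : ℝ} (hC : 0 < C) (hC1 : C ≤ 1) (hf : poa f = C) :
    pob f 1 ≤ optimalPob C := by
  have h1 : f 1 ≠ 0 := fun h => hC.ne' (hf ▸ poa_eq_zero_of_apply_one h)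
  -- A positive PoB bounds the partial sums and so forces convergence; a divergent series is thus
  -- possible only in the zero case.
  rcases (pob_nonneg f 1).eq_or_lt with h0 | h0
  · rw [← h0]; exact ENNReal.toReal_nonneg
  have hb : ∀ n, ∑ j ∈ Finset.range n, tradeoffTerm ((1 - C) / C) j ≤ (pob f 1)⁻¹ - 1 :=
    fun n => by
    have hle := pob_le_inv h1 n
    have hnn : 0 ≤ ∑ i ∈ Finset.range n, (f (i + 1) : ℝ) / f 1 :=
      Finset.sum_nonneg fun i _ => by positivity
    rw [le_inv_comm₀ h0 (by positivity)] at hle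
    have := Finset.sum_le_sum fun j (_ : j ∈ Finset.range n) =>
      tradeoffTerm_le_div hC hC1 hf h1 j
    linarith
  have hs := summable_of_sum_range_le (tradeoffTerm_nonneg _) hb
  have ht := Real.tsum_le_of_sum_range_le (tradeoffTerm_nonneg _) hb
  have hnn : 0 ≤ ∑' j, tradeoffTerm ((1 - C) / C) j := tsum_nonneg (tradeoffTerm_nonneg _)
  rw [optimalPob_eq_of_summable hs, le_inv_comm₀ h0 (by positivity)]
  linarith

/-- The utility rule attaining the trade-off. -/
noncomputable def tradeoffRule (χ : ℝ) : UtilityRule := fun j => (tradeoffTerm χ (j - 1)).toNNReal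

lemma coe_tradeoffRule_succ (χ : ℝ) (j : ℕ) :
    (tradeoffRule χ (j + 1) : ℝ) = tradeoffTerm χ j :=
  Real.coe_toNNReal _ (tradeoffTerm_nonneg _ _)

lemma tradeoffRule_one (χ : ℝ) : tradeoffRule χ 1 = 1 := by
  rw [← NNReal.coe_inj]
  simpa [tradeoffTerm_zero] using coe_tradeoffRule_succ χ 0

lemma poa_tradeoffRule {C : ℝ} (hC : 0 < C) (h1 : (1 - C) / C ≤ 1)
    (h2 : 1 / (Real.exp 1 - 1) ≤ (1 - C) / C) : poa (tradeoffRule ((1 - C) / C)) = C := by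
  have he : 0 < Real.exp 1 - 1 := by linarith [Real.add_one_lt_exp one_ne_zero]
  have hinv : 1 + (1 - C) / C = C⁻¹ := by field_simp; ring
  set χ := (1 - C) / C
  have hχ : 0 ≤ χ := le_trans (by positivity) h2
  refine le_antisymm ?_ (le_poa fun n G a ha o => ?_)
  -- Since χ ≤ 1, that is C ≥ 1/2, no truncation occurs in f(2) = 1 - χ, and the constraint at `j =
  -- 1` is tight.
  · have h := poa_le_inv_one_add (f := tradeoffRule χ) (j := 1) (θ := χ.toNNReal) (by
      have e := coe_tradeoffRule_succ χ 1
      rw [tradeoffTerm_succ hχ, tradeoffTerm_zero] at e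
      rw [← NNReal.coe_le_coe]
      push_cast
      rw [e, Real.coe_toNNReal _ hχ, tradeoffRule_one, Nat.cast_zero, max_eq_left (by linarith)]
      simp)
    rwa [Real.coe_toNNReal _ hχ, hinv, inv_inv] at h
  · have h := G.welfare_le_of_mem_nashEquilibria (χ := χ) (tradeoffRule_one χ) (fun j hj => by
      obtain ⟨j, rfl⟩ := Nat.exists_eq_add_of_le' hj
      rw [← NNReal.coe_le_coe, coe_tradeoffRule_succ, coe_tradeoffRule_succ]
      exact tradeoffTerm_succ_le h2 j) (fun j hj => by
      obtain ⟨j, rfl⟩ := Nat.exists_eq_add_of_le' hj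
      rw [coe_tradeoffRule_succ, coe_tradeoffRule_succ, tradeoffTerm_succ hχ]
      push_cast
      linarith [le_max_left ((j + 1) * tradeoffTerm χ j - χ) 0]) ha o
    rw [hinv] at h
    rwa [le_inv_mul_iff₀ hC] at h

lemma optimalPob_le_pob_tradeoffRule (C : ℝ) :
    optimalPob C ≤ pob (tradeoffRule ((1 - C) / C)) 1 := by
  by_cases hs : Summable (tradeoffTerm ((1 - C) / C))
  · rw [optimalPob_eq_of_summable hs]
    have hnn : 0 ≤ ∑' j, tradeoffTerm ((1 - C) / C) j := tsum_nonneg (tradeoffTerm_nonneg _)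
    refine le_pob fun n G a ha o => ?_
    rw [inv_mul_le_iff₀ (by positivity), add_comm]
    refine G.welfare_le_of_mem_endStates (tradeoffRule_one _) (fun m => ?_) ha o
    simp_rw [coe_tradeoffRule_succ]
    exact hs.sum_le_tsum _ fun j _ => tradeoffTerm_nonneg _ _
  · rw [optimalPob_eq_zero_of_not_summable hs]
    exact pob_nonneg _ _

theorem theorem2 :
    (∀ C : ℝ, 1 / 2 ≤ C → C ≤ 1 - 1 / Real.exp 1 →
      IsGreatest {p : ℝ | ∃ f : UtilityRule, poa f = C ∧ pob f 1 = p} (optimalPob C)) ∧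
    (∀ f : UtilityRule, poa f = 1 - 1 / Real.exp 1 → pob f 1 = 0) := by
  have he0 : 0 < Real.exp 1 := Real.exp_pos 1
  have he : 0 < Real.exp 1 - 1 := by linarith [Real.add_one_lt_exp one_ne_zero]
  have hc : 1 - 1 / Real.exp 1 = (Real.exp 1 - 1) / Real.exp 1 := by field_simp
  have hc1 : 1 - 1 / Real.exp 1 ≤ 1 := by linarith [one_div_pos.2 he0]
  refine ⟨fun C h1 h2 => ?_, fun f hf => ?_⟩
  · have hC : 0 < C := by linarith
    have hC1 : C ≤ 1 := h2.trans hc1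
    have hpoa : poa (tradeoffRule ((1 - C) / C)) = C := by
      refine poa_tradeoffRule hC ?_ ?_
      · rw [div_le_one hC]; linarith
      · rw [hc, le_div_iff₀ he0] at h2
        rw [div_le_div_iff₀ he hC]
        linarith
    refine ⟨⟨_, hpoa, le_antisymm (pob_le_optimalPob hC hC1 hpoa)
      (optimalPob_le_pob_tradeoffRule C)⟩, ?_⟩
    rintro _ ⟨f, hf, rfl⟩
    exact pob_le_optimalPob hC hC1 hf
  · have hpos : 0 < 1 - 1 / Real.exp 1 := by rw [hc]; positivity
    refine le_antisymm ((pob_le_optimalPob hpos hc1 hf).trans_eq ?_) (pob_nonneg f 1)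
    refine optimalPob_eq_zero_of_not_summable ?_
    rw [show (1 - (1 - 1 / Real.exp 1)) / (1 - 1 / Real.exp 1) = 1 / (Real.exp 1 - 1) by
      rw [hc]; field_simp; ring]
    exact not_summable_tradeoffTerm
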